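/- Let $G$ be a finite group of order $N$ and let $S\subseteq G$ be closed under conjugation ($gSg^{-1}=S$ for all $g\in G$). Let $\Gamma=\mathrm{Cay}(G;S)$ be the (possibly directed) Cayley graph with vertex set $G$ and an edge from $x$ to $y$ if and only if $x^{-1}y\in S$. Let $A$ be its adjacency matrix ($A_{x,y}=1$ if there is an edge from $x$ to $y$, and $A_{x,y}=0$ otherwise) and let $L$ be its Laplacian matrix (the diagonal out-degree matrix minus $A$). Let $\widehat G$ be the set of equivalence classes of irreducible unitary representations of $G$, and choose for each class a representative $\pi=(\pi_{i,j})_{i,j=1}^{d_\pi}:G\to \mathrm{U}_{d_\pi}(\mathbb C)$, of degree $d_\pi$ and with character $\chi_\pi=\mathrm{Tr}\,\pi$. Put $$\phi^\pi_{i,j}=\sqrt{d_\pi/N}\;\pi_{i,j}:G\to\mathbb C\qquad(\pi\in\widehat G,\ 1\le i,j\le d_\pi).$$ Then the vectors $\phi^\pi_{i,j}$ form an orthonormal basis of $\mathbb C^G$ consisting of eigenvectors of $A$ and of $L$. Let $\Phi$ be the matrix with columns $\phi^\pi_{i,j}$. For $\mathfrak f,\mathfrak g:G\to\mathbb C$ let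 $\widehat{\mathfrak f}=\Phi^*\mathfrak f$, that is, $\widehat{\mathfrak f}(\phi^\pi_{i,j})=\sum_{x\in G}\mathfrak f(x)\overline{\phi^\pi_{i,j}(x)}$, let $\mathfrak f*\mathfrak g=\Phi(\widehat{\mathfrak f}\circ\widehat{\mathfrak g})$ with $\circ$ the entrywise product, and let $T_\ell\mathfrak f=\sqrt N\,(\mathfrak f*\delta_\ell)$ be the graph translation, where $\delta_\ell$ is the Kronecker delta at $\ell\in G$. Suppose that $\mathfrak g:G\to\mathbb C$ is such that for every $\pi\in\widehat G$ there is a constant $\widehat{\mathfrak g}_\pi\in\mathbb C$ with $\widehat{\mathfrak g}(\phi^\pi_{i,j})=\widehat{\mathfrak g}_\pi$ for all $1\le i,j\le d_\pi$. Then for all $\ell,k\in G$, $$(T_\ell\mathfrak g)(k)=\frac1{\sqrt N}\sum_{\pi\in\widehat G}d_\pi\,\widehat{\mathfrak g}_\pi\,\chi_\pi(\ell^{-1}k).$$ -/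

import Mathlib

open scoped Matrix

noncomputable section

/-! ### Signals on a finite vertex set and the graph Fourier transform -/

namespace GraphSignal

variable {V ι : Type*} [Fintype V] [Fintype ι]

/-- The matrix `Φ` whose columns are the vectors `φ a`. -/
def basisMatrix (φ : ι → V → ℂ) : Matrix V ι ℂ := Matrix.of fun v a => φ a v

/-- The graph Fourier transform `f̂ = Φ* f`, that is `f̂(φ a) = ∑ v, f v * conj (φ a v)`. -/
def fourier (φ : ι → V → ℂ) (f : V → ℂ) : ι → ℂ := (basisMatrix φ)ᴴ *ᵥ f

/-- The convolution `f * g = Φ (f̂ ∘ ĝ)`, with `∘` the entrywise product. -/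
def conv (φ : ι → V → ℂ) (f g : V → ℂ) : V → ℂ :=
  basisMatrix φ *ᵥ (fourier φ f * fourier φ g)

/-- The graph translation `T_v f = √N (f * δ_v)`, where `N` is the number of vertices. -/
def translation [DecidableEq V] (φ : ι → V → ℂ) (v : V) (f : V → ℂ) : V → ℂ :=
  ((Real.sqrt (Fintype.card V) : ℝ) : ℂ) • conv φ f (Pi.single v 1)

/-- `φ` is an orthonormal basis of `ℂ^V` that consists of eigenvectors of `M`. -/
structure IsOrthonormalEigenbasis [DecidableEq V] (M : Matrix V V ℂ) (φ : ι → V → ℂ) :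
    Prop where
  orthonormal : Orthonormal ℂ fun a => (WithLp.toLp 2 (φ a) : EuclideanSpace ℂ V)
  span_eq_top : Submodule.span ℂ (Set.range φ) = ⊤
  eigenvector : ∀ a, ∃ μ : ℂ, Module.End.HasEigenvector (Matrix.toLin' M) μ (φ a)

open scoped Classical in
/-- The adjacency matrix of a directed graph. -/
def adjMatrix (Γ : Digraph V) : Matrix V V ℂ :=
  Matrix.of fun v w => if Γ.Adj v w then 1 else 0

/-- The Laplacian matrix of a directed graph: out-degree matrix minus adjacency matrix. -/
def lapMatrix [DecidableEq V] (Γ : Digraph V) : Matrix V V ℂ :=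
  Matrix.diagonal (fun v => ∑ w, adjMatrix Γ v w) - adjMatrix Γ

end GraphSignal

/-- The Cayley graph `Cay(G; S)`: there is an edge from `x` to `y` iff `x⁻¹ y ∈ S`.
It is directed in general, and may have loops. -/
def cayleyDigraph {G : Type*} [Group G] (S : Set G) : Digraph G where
  Adj x y := x⁻¹ * y ∈ S

/-- `S` is closed under conjugation: `g S g⁻¹ = S` for all `g`. -/
def IsConjClosed {G : Type*} [Group G] (S : Set G) : Prop :=
  ∀ g : G, (fun s => g * s * g⁻¹) '' S = S

/-! ### Irreducible unitary representations -/

/-- The linear representation on `ℂ^d` given by a homomorphism into the unitary matrices. -/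
def unitaryToRep {G : Type*} [Group G] {d : ℕ} (ρ : G →* Matrix.unitaryGroup (Fin d) ℂ) :
    Representation ℂ G (Fin d → ℂ) :=
  ((Matrix.toLinAlgEquiv' : Matrix (Fin d) (Fin d) ℂ ≃ₐ[ℂ] _) :
    Matrix (Fin d) (Fin d) ℂ →* Module.End ℂ (Fin d → ℂ)).comp
      ((Matrix.unitaryGroup (Fin d) ℂ).subtype.comp ρ)

/-- An irreducible unitary representation of `G`: a homomorphism `G → U_d(ℂ)` that is
irreducible. -/
structure IrredUnitaryRep (G : Type*) [Group G] where
  degree : ℕ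
  toHom : G →* Matrix.unitaryGroup (Fin degree) ℂ
  irreducible : (unitaryToRep toHom).IsIrreducible

namespace IrredUnitaryRep

variable {G : Type*} [Group G]

/-- The coordinate functional `π_{i,j}(g)`, the `(i, j)` entry of the matrix `π(g)`. -/
def coeff (π : IrredUnitaryRep G) (i j : Fin π.degree) (g : G) : ℂ :=
  (π.toHom g : Matrix (Fin π.degree) (Fin π.degree) ℂ) i j

/-- The character `χ_π(g) = Tr π(g)`. -/
def character (π : IrredUnitaryRep G) (g : G) : ℂ :=
  (π.toHom g : Matrix (Fin π.degree) (Fin π.degree) ℂ).trace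

/-- Equivalence of irreducible unitary representations: there is an invertible
intertwining map. -/
instance setoid (G : Type*) [Group G] : Setoid (IrredUnitaryRep G) where
  r π σ := Nonempty ((unitaryToRep π.toHom).Equiv (unitaryToRep σ.toHom))
  iseqv :=
    { refl := fun _ => ⟨Representation.Equiv.refl _⟩
      symm := fun ⟨e⟩ => ⟨e.symm⟩
      trans := fun ⟨e⟩ ⟨f⟩ => ⟨e.trans f⟩ }

end IrredUnitaryRep

/-- The unitary dual `Ĝ`: the set of equivalence classes of irreducible unitary
representations of `G`. -/
def UnitaryDual (G : Type*) [Group G] := Quotient (IrredUnitaryRep.setoid G)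

namespace UnitaryDual

/-- The equivalence class of an irreducible unitary representation. -/
def mk {G : Type*} [Group G] (π : IrredUnitaryRep G) : UnitaryDual G :=
  Quotient.mk (IrredUnitaryRep.setoid G) π

/-- A finite group has finitely many irreducible unitary representations up to equivalence. -/
theorem finite (G : Type*) [Group G] [Finite G] : Finite (UnitaryDual G) := by
  classical
  have := Fintype.ofFinite G
  have hN : (Nat.card G : ℂ) ≠ 0 := by simp
  have : Invertible (Nat.card G : ℂ) := invertibleOfNonzero hN
  let χ : UnitaryDual G → G → ℂ := fun c => (unitaryToRep (Quotient.out c).toHom).character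
  have horth : ∀ c c', (Nat.card G : ℂ)⁻¹ * ∑ g : G, χ c g * χ c' g⁻¹ =
      if c = c' then 1 else 0 := by
    intro c c'
    have h1 := (Quotient.out c).irreducible
    have h2 := (Quotient.out c').irreducible
    have h3 : Nonempty ((unitaryToRep (Quotient.out c').toHom).Equiv
        (unitaryToRep (Quotient.out c).toHom)) ↔ c = c' := by
      rw [eq_comm]
      exact Quotient.out_equiv_out (s := IrredUnitaryRep.setoid G) (x := c') (y := c)
    rw [Representation.char_orthonormal]
    simp [h3]
  have hli : LinearIndependent ℂ χ := by
    rw [linearIndependent_iff']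
    intro s a ha c hc
    have h0 : (Nat.card G : ℂ)⁻¹ * ∑ g : G, (∑ b ∈ s, a b • χ b) g * χ c g⁻¹ = 0 := by
      rw [ha]
      simp
    have h1 : (Nat.card G : ℂ)⁻¹ * ∑ g : G, (∑ b ∈ s, a b • χ b) g * χ c g⁻¹
        = ∑ b ∈ s, a b * ((Nat.card G : ℂ)⁻¹ * ∑ g : G, χ b g * χ c g⁻¹) := by
      simp only [Finset.sum_apply, Pi.smul_apply, smul_eq_mul, Finset.sum_mul, Finset.mul_sum]
      rw [Finset.sum_comm]
      refine Finset.sum_congr rfl fun b _ => Finset.sum_congr rfl fun g _ => by ring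
    rw [h1] at h0
    simp only [horth] at h0
    simpa [hc] using h0
  exact hli.finite

instance instFintype (G : Type*) [Group G] [Finite G] : Fintype (UnitaryDual G) :=
  @Fintype.ofFinite _ (UnitaryDual.finite G)

end UnitaryDual

/-- The index set `{(π, i, j) : π ∈ Ĝ, 1 ≤ i, j ≤ d_π}`, for a choice `π` of representatives of
the classes in `Ĝ`. -/
abbrev CoeffIndex {G : Type*} [Group G] (π : UnitaryDual G → IrredUnitaryRep G) :=
  (c : UnitaryDual G) × Fin (π c).degree × Fin (π c).degree

/-- The scaled coordinate functionals `φ^π_{i,j} = √(d_π / N) π_{i,j}`, with `N = |G|`. -/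
def coeffBasis {G : Type*} [Group G] [Fintype G] (π : UnitaryDual G → IrredUnitaryRep G)
    (a : CoeffIndex π) : G → ℂ :=
  fun x => ((Real.sqrt ((π a.1).degree / Fintype.card G) : ℝ) : ℂ) *
    (π a.1).coeff a.2.1 a.2.2 x

end

/-! This is Peter–Weyl for a finite group, followed by a trace computation. Averaging over `G` and
Schur's lemma make the `φ^π_{i,j}` orthonormal. By Maschke, `ℂ^G` under right translation is
generated by irreducible subrepresentations; evaluation at `1` writes their members as combinations
of matrix coefficients, so the span is everything (`span_range_coeffBasis`).

Conjugation invariance of `S` makes `∑_{s∈S} π(s)` commute with every `π(g)`, hence scalar. That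
scalar is the eigenvalue of `A` on each `π_{i,j}`, and `L` differs from `-A` by a scalar matrix.

For the translation formula, `δ̂_ℓ` has entries `conj φ^π_{i,j}(ℓ)`. As `ĝ` is constant on each
block, the sum over `i, j` becomes `Tr(π(ℓ)* π(k)) = χ_π(ℓ⁻¹k)` (`conv_single_coeffBasis`). -/

namespace Representation

/-! ### Irreducibility in terms of invariant submodules -/

variable {G k V W : Type*} [Monoid G] [Field k] [AddCommGroup V] [Module k V] [AddCommGroup W]
  [Module k W]

theorem isIrreducible_of_forall_submodule [Nontrivial V] (ρ : Representation k G V)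
    (h : ∀ p : Submodule k V, (∀ g, ∀ v ∈ p, ρ g v ∈ p) → p = ⊥ ∨ p = ⊤) : ρ.IsIrreducible where
  exists_pair_ne := by
    refine ⟨⊥, ⊤, fun h => ?_⟩
    exact bot_ne_top (α := Submodule k V) (congrArg Subrepresentation.toSubmodule h)
  eq_bot_or_eq_top p :=
    (h p.toSubmodule fun g _ hv => p.apply_mem_toSubmodule g hv).imp
      (fun h => Subrepresentation.toSubmodule_injective h)
      (fun h => Subrepresentation.toSubmodule_injective h)

theorem IsIrreducible.submodule_eq_bot_or_eq_top {ρ : Representation k G V} (hρ : ρ.IsIrreducible)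
    (p : Submodule k V) (hp : ∀ g, ∀ v ∈ p, ρ g v ∈ p) : p = ⊥ ∨ p = ⊤ :=
  (hρ.eq_bot_or_eq_top ⟨p, fun g _ hv => hp g _ hv⟩).imp
    (fun h => congrArg Subrepresentation.toSubmodule h)
    (fun h => congrArg Subrepresentation.toSubmodule h)

theorem IsIrreducible.nontrivial {ρ : Representation k G V} (hρ : ρ.IsIrreducible) :
    Nontrivial V := by
  by_contra hV
  rw [not_nontrivial_iff_subsingleton] at hV
  obtain ⟨p, q, hpq⟩ := hρ.exists_pair_ne
  exact hpq (Subrepresentation.toSubmodule_injective (Subsingleton.elim _ _))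

theorem IsIrreducible.of_linearEquiv {ρ : Representation k G V} {σ : Representation k G W}
    (hρ : ρ.IsIrreducible) (e : V ≃ₗ[k] W) (he : ∀ g v, e (ρ g v) = σ g (e v)) :
    σ.IsIrreducible := by
  have := hρ.nontrivial
  have := e.symm.toEquiv.nontrivial
  refine isIrreducible_of_forall_submodule σ fun p hp => ?_
  have h := hρ.submodule_eq_bot_or_eq_top (p.comap (e : V →ₗ[k] W)) fun g v hv => by
    simpa [he] using hp g _ hv
  have hmap : (p.comap (e : V →ₗ[k] W)).map (e : V →ₗ[k] W) = p :=
    Submodule.map_comap_eq_of_surjective e.surjective p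
  rcases h with h | h
  · left; rw [← hmap, h, Submodule.map_bot]
  · right; rw [← hmap, h, Submodule.map_top, LinearEquiv.range]

/-- An atom in the lattice of subrepresentations is an irreducible representation. -/
theorem isIrreducible_toRepresentation {ρ : Representation k G V} {U : Subrepresentation ρ}
    (hU : IsAtom U) : U.toRepresentation.IsIrreducible := by
  have hne : U.toSubmodule ≠ ⊥ := fun h => hU.1 (Subrepresentation.toSubmodule_injective h)
  have : Nontrivial U.toSubmodule := Submodule.nontrivial_iff_ne_bot.mpr hne
  refine isIrreducible_of_forall_submodule _ fun p hp => ?_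
  let P : Subrepresentation ρ := ⟨p.map U.toSubmodule.subtype, by
    rintro g _ ⟨v, hv, rfl⟩
    exact ⟨_, hp g v hv, rfl⟩⟩
  have hPU : P ≤ U := by
    rintro _ ⟨v, hv, rfl⟩
    exact v.2
  rcases hU.le_iff.mp hPU with h | h
  · left
    have h' : p.map U.toSubmodule.subtype = ⊥ := congrArg Subrepresentation.toSubmodule h
    apply Submodule.map_injective_of_injective U.toSubmodule.injective_subtype
    rw [h', Submodule.map_bot]
  · right
    have h' : p.map U.toSubmodule.subtype = U.toSubmodule :=
      congrArg Subrepresentation.toSubmodule h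
    apply Submodule.map_injective_of_injective U.toSubmodule.injective_subtype
    rw [h', Submodule.map_subtype_top]

end Representation

/-! ### Schur's lemma for matrices -/

namespace IrredUnitaryRep

variable {G : Type*} [Group G]

/-- The matrix `π(g)`. -/
abbrev mat (π : IrredUnitaryRep G) (g : G) : Matrix (Fin π.degree) (Fin π.degree) ℂ :=
  (π.toHom g : Matrix (Fin π.degree) (Fin π.degree) ℂ)

theorem mat_mul (π : IrredUnitaryRep G) (g h : G) : π.mat (g * h) = π.mat g * π.mat h := by
  simp [mat]

theorem mat_one (π : IrredUnitaryRep G) : π.mat 1 = 1 := by simp [mat]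

theorem mat_inv (π : IrredUnitaryRep G) (g : G) : π.mat g⁻¹ = (π.mat g)ᴴ := by
  simp only [mat, map_inv]
  rfl

theorem degree_pos (π : IrredUnitaryRep G) : 0 < π.degree := by
  have := π.irreducible.nontrivial
  by_contra h
  have : IsEmpty (Fin π.degree) := by
    rw [Nat.eq_zero_of_not_pos h]
    infer_instance
  exact not_subsingleton (Fin π.degree → ℂ) inferInstance

/-- The intertwining map given by a matrix that intertwines two irreducible unitary
representations. -/
def intertwiningMap {π σ : IrredUnitaryRep G} (M : Matrix (Fin σ.degree) (Fin π.degree) ℂ)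
    (hM : ∀ g, σ.mat g * M = M * π.mat g) :
    (unitaryToRep π.toHom).IntertwiningMap (unitaryToRep σ.toHom) where
  toLinearMap := Matrix.toLin' M
  isIntertwining' g := by
    refine LinearMap.ext fun v => ?_
    change M *ᵥ (π.mat g *ᵥ v) = σ.mat g *ᵥ (M *ᵥ v)
    rw [Matrix.mulVec_mulVec, Matrix.mulVec_mulVec, hM]

/-- A nonzero intertwiner of irreducibles is bijective, hence would be an equivalence. -/
theorem eq_zero_of_intertwines {π σ : IrredUnitaryRep G} (hne : UnitaryDual.mk π ≠ UnitaryDual.mk σ)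
    (M : Matrix (Fin σ.degree) (Fin π.degree) ℂ) (hM : ∀ g, σ.mat g * M = M * π.mat g) :
    M = 0 := by
  have := π.irreducible
  have := σ.irreducible
  rcases Representation.IsIrreducible.bijective_or_eq_zero (intertwiningMap M hM) with h | h
  · exact (hne (Quotient.sound ⟨(intertwiningMap M hM).ofBijective h⟩)).elim
  · exact Matrix.toLin'.map_eq_zero_iff.mp
      (congrArg Representation.IntertwiningMap.toLinearMap h)

theorem exists_eq_smul_one_of_commute (π : IrredUnitaryRep G)
    (M : Matrix (Fin π.degree) (Fin π.degree) ℂ) (hM : ∀ g, π.mat g * M = M * π.mat g) :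
    ∃ c : ℂ, M = c • 1 := by
  have := π.irreducible
  obtain ⟨c, hc⟩ := (Representation.IsIrreducible.algebraMap_intertwiningMap_bijective_of_isAlgClosed
    (ρ := unitaryToRep π.toHom)).2 (intertwiningMap M hM)
  refine ⟨c, Matrix.toLin'.injective ?_⟩
  have h := congrArg Representation.IntertwiningMap.toLinearMap hc
  rw [map_smul, Matrix.toLin'_one]
  exact h.symm

/-! ### Schur orthogonality relations -/

section Orthogonality

variable [Fintype G]

/-- The intertwining matrix `∑ g, σ(g) M π(g)*` obtained from `M` by averaging. -/
def avgMatrix (π σ : IrredUnitaryRep G) (M : Matrix (Fin σ.degree) (Fin π.degree) ℂ) :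
    Matrix (Fin σ.degree) (Fin π.degree) ℂ :=
  ∑ g, σ.mat g * M * (π.mat g)ᴴ

/-- Reindex the sum by `g ↦ h g`; unitarity turns `π(g)*` into `π(g⁻¹)`. -/
theorem avgMatrix_intertwines (π σ : IrredUnitaryRep G) (M : Matrix (Fin σ.degree) (Fin π.degree) ℂ)
    (h : G) : σ.mat h * avgMatrix π σ M = avgMatrix π σ M * π.mat h := by
  rw [avgMatrix, Matrix.mul_sum, Matrix.sum_mul]
  refine Fintype.sum_equiv (Equiv.mulLeft h) _ _ fun g => ?_
  rw [Equiv.coe_mulLeft, ← mat_inv, ← mat_inv, mul_inv_rev, mat_mul, mat_mul,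
    Matrix.mul_assoc _ _ (π.mat h), Matrix.mul_assoc _ (π.mat h⁻¹), ← mat_mul π h⁻¹ h, inv_mul_cancel, mat_one, Matrix.mul_one]
  simp only [Matrix.mul_assoc]

/-- Averaging an elementary matrix isolates one product of coefficients, which brings the
orthogonality sums within reach of Schur's lemma. -/
theorem avgMatrix_single_apply (π σ : IrredUnitaryRep G) (i j : Fin π.degree)
    (k l : Fin σ.degree) :
    avgMatrix π σ (Matrix.single l j 1) k i =
      ∑ g, σ.coeff k l g * star (π.coeff i j g) := by
  rw [avgMatrix, Matrix.sum_apply]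
  refine Finset.sum_congr rfl fun g _ => ?_
  simp [Matrix.mul_apply, Matrix.single_apply, coeff, ite_and, Finset.sum_ite_eq]

theorem sum_coeff_mul_star_coeff_of_ne {π σ : IrredUnitaryRep G}
    (hne : UnitaryDual.mk π ≠ UnitaryDual.mk σ) (i j : Fin π.degree) (k l : Fin σ.degree) :
    ∑ g, σ.coeff k l g * star (π.coeff i j g) = 0 := by
  rw [← avgMatrix_single_apply, eq_zero_of_intertwines hne _ (avgMatrix_intertwines π σ _)]
  rfl

/-- The average is a scalar `c • 1`, and the trace determines `c`: each of the `N` summands is a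
conjugate of the elementary matrix at `(l, j)`, so `c * d_π` is `N` if `l = j` and `0` otherwise. -/
theorem sum_coeff_mul_star_coeff (π : IrredUnitaryRep G) (i j k l : Fin π.degree) :
    ∑ g, π.coeff k l g * star (π.coeff i j g) =
      if k = i ∧ l = j then (Fintype.card G : ℂ) / π.degree else 0 := by
  rw [← avgMatrix_single_apply]
  obtain ⟨c, hc⟩ := exists_eq_smul_one_of_commute π _ (avgMatrix_intertwines π π (Matrix.single l j 1))
  have hd : (π.degree : ℂ) ≠ 0 := by exact_mod_cast π.degree_pos.ne'
  have htr := congrArg Matrix.trace hc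
  rw [avgMatrix, Matrix.trace_sum] at htr
  have hterm : ∀ g, (π.mat g * Matrix.single l j 1 * (π.mat g)ᴴ).trace =
      if l = j then 1 else 0 := by
    intro g
    rw [Matrix.trace_mul_comm, ← Matrix.mul_assoc, ← mat_inv, ← mat_mul, inv_mul_cancel, mat_one,
      Matrix.one_mul]
    split_ifs with h
    · rw [h, Matrix.trace_single_eq_same]
    · exact Matrix.trace_single_eq_of_ne _ _ _ h
  simp only [hterm, Matrix.trace_smul, Matrix.trace_one, Fintype.card_fin, smul_eq_mul,
    Finset.sum_const, Finset.card_univ, nsmul_eq_mul] at htr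
  rw [hc, Matrix.smul_apply, Matrix.one_apply, smul_eq_mul, eq_div_of_mul_eq hd htr.symm]
  by_cases h1 : k = i <;> by_cases h2 : l = j <;> simp [h1, h2]

end Orthogonality

/-! ### From isometric representations to unitary matrices -/

section Unitarization

variable {E : Type*} [NormedAddCommGroup E] [InnerProductSpace ℂ E] [FiniteDimensional ℂ E]

omit [FiniteDimensional ℂ E] in
-- By Parseval, entry `(i, j)` of `M* M` is `⟪f (b i), f (b j)⟫`.
theorem toMatrix_mem_unitaryGroup {n : Type*} [Fintype n] [DecidableEq n]
    (b : OrthonormalBasis n ℂ E) (f : E →ₗ[ℂ] E)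
    (hf : ∀ x y, inner ℂ (f x) (f y) = inner ℂ x y) :
    LinearMap.toMatrix b.toBasis b.toBasis f ∈ Matrix.unitaryGroup n ℂ := by
  rw [Matrix.mem_unitaryGroup_iff']
  ext i j
  have h : ∀ k l, LinearMap.toMatrix b.toBasis b.toBasis f k l = inner ℂ (b k) (f (b l)) := by
    intro k l
    simp [LinearMap.toMatrix_apply, OrthonormalBasis.repr_apply_apply]
  simp only [Matrix.mul_apply, Matrix.star_apply, h, RCLike.star_def, inner_conj_symm,
    OrthonormalBasis.sum_inner_mul_inner, hf, OrthonormalBasis.inner_eq_ite, Matrix.one_apply]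

/-- An irreducible representation by isometries of a finite-dimensional inner product space is
equivalent to a unitary matrix representation. -/
theorem exists_linearEquiv (ρ : Representation ℂ G E) (hρ : ρ.IsIrreducible)
    (hisom : ∀ g x y, inner ℂ (ρ g x) (ρ g y) = inner ℂ x y) :
    ∃ (σ : IrredUnitaryRep G) (e : E ≃ₗ[ℂ] (Fin σ.degree → ℂ)),
      ∀ g x, e (ρ g x) = σ.mat g *ᵥ e x := by
  let b := stdOrthonormalBasis ℂ E
  let τ : G →* Matrix.unitaryGroup (Fin (Module.finrank ℂ E)) ℂ :=
    { toFun := fun g => ⟨LinearMap.toMatrix b.toBasis b.toBasis (ρ g),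
        toMatrix_mem_unitaryGroup b _ (hisom g)⟩
      map_one' := by ext1; simp
      map_mul' := fun g h => by ext1; simp [LinearMap.toMatrix_mul] }
  have he : ∀ g x, b.toBasis.equivFun (ρ g x) = unitaryToRep τ g (b.toBasis.equivFun x) :=
    fun g x => (LinearMap.toMatrix_mulVec_repr b.toBasis b.toBasis (ρ g) x).symm
  exact ⟨⟨_, τ, hρ.of_linearEquiv b.toBasis.equivFun he⟩, b.toBasis.equivFun, he⟩

end Unitarization

end IrredUnitaryRep

/-! ### The right regular representation and complete reducibility -/

section RegularRepresentation

variable (G : Type*) [Group G]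

/-- The right regular representation of `G` on `ℂ^G`. -/
def rightRegularRep : Representation ℂ G (EuclideanSpace ℂ G) where
  toFun g :=
    { toFun := fun f => WithLp.toLp 2 fun x => f (x * g)
      map_add' := fun _ _ => rfl
      map_smul' := fun _ _ => rfl }
  map_one' := by ext; simp
  map_mul' g h := by
    ext f x
    change f (x * (g * h)) = f (x * g * h)
    rw [mul_assoc]

variable {G}

theorem rightRegularRep_apply (g : G) (f : EuclideanSpace ℂ G) (x : G) :
    rightRegularRep G g f x = f (x * g) := rfl

theorem inner_rightRegularRep [Fintype G] (g : G) (f h : EuclideanSpace ℂ G) :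
    inner ℂ (rightRegularRep G g f) (rightRegularRep G g h) = inner ℂ f h := by
  simp only [PiLp.inner_apply, rightRegularRep_apply]
  exact Fintype.sum_equiv (Equiv.mulRight g) _ _ fun _ => rfl

/-- A subrepresentation of a complex representation of a finite group that contains all
irreducible ones is everything. -/
theorem Representation.eq_top_of_forall_isAtom_le [Finite G]
    {V : Type*} [AddCommGroup V] [Module ℂ V] (ρ : Representation ℂ G V)
    (P : Subrepresentation ρ) (h : ∀ U : Subrepresentation ρ, IsAtom U → U ≤ P) : P = ⊤ := by
  -- This is the hypothesis of Maschke's theorem, by which the submodule lattice over the group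
  -- algebra is generated by its atoms.
  have : NeZero (Nat.card G : ℂ) := ⟨Nat.cast_ne_zero.mpr Nat.card_pos.ne'⟩
  let e := Subrepresentation.subrepresentationSubmoduleOrderIso (ρ := ρ)
  apply e.injective
  rw [e.map_top, eq_top_iff, ← sSup_atoms_eq_top]
  refine sSup_le fun m hm => ?_
  rw [← e.apply_symm_apply m, e.le_iff_le]
  exact h _ ((e.symm.isAtom_iff m).mpr hm)

end RegularRepresentation

/-! ### Orthonormality and completeness of the matrix coefficients -/

section CoeffBasis

variable {G : Type*} [Group G] [Fintype G] (π : UnitaryDual G → IrredUnitaryRep G)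

theorem coeffBasis_apply (c : UnitaryDual G) (i j : Fin (π c).degree) (x : G) :
    coeffBasis π ⟨c, i, j⟩ x =
      ((Real.sqrt ((π c).degree / Fintype.card G) : ℝ) : ℂ) * (π c).mat x i j := rfl

theorem degree_div_card_pos (c : UnitaryDual G) :
    (0 : ℝ) < (π c).degree / Fintype.card G :=
  div_pos (by exact_mod_cast (π c).degree_pos) (by exact_mod_cast Fintype.card_pos)

theorem sqrt_degree_div_card_mul_self (c : UnitaryDual G) :
    ((Real.sqrt ((π c).degree / Fintype.card G) : ℝ) : ℂ) *
      ((Real.sqrt ((π c).degree / Fintype.card G) : ℝ) : ℂ) = (π c).degree / Fintype.card G := by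
  rw [← Complex.ofReal_mul, Real.mul_self_sqrt (degree_div_card_pos π c).le]
  push_cast
  rfl

theorem sqrt_degree_div_card_ne_zero (c : UnitaryDual G) :
    ((Real.sqrt ((π c).degree / Fintype.card G) : ℝ) : ℂ) ≠ 0 :=
  Complex.ofReal_ne_zero.mpr (Real.sqrt_pos.mpr (degree_div_card_pos π c)).ne'

theorem coeff_mem_span (c : UnitaryDual G) (i j : Fin (π c).degree) :
    (fun x => (π c).mat x i j) ∈ Submodule.span ℂ (Set.range (coeffBasis π)) := by
  have h : (fun x => (π c).mat x i j) =
      ((Real.sqrt ((π c).degree / Fintype.card G) : ℝ) : ℂ)⁻¹ • coeffBasis π ⟨c, i, j⟩ := by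
    funext x
    rw [Pi.smul_apply, coeffBasis_apply, smul_eq_mul,
      inv_mul_cancel_left₀ (sqrt_degree_div_card_ne_zero π c)]
  rw [h]
  exact Submodule.smul_mem _ _ (Submodule.subset_span ⟨_, rfl⟩)

/-- The span of the matrix coefficients, as a subrepresentation of the right regular
representation. -/
def coeffSpan : Subrepresentation (rightRegularRep G) where
  toSubmodule := (Submodule.span ℂ (Set.range (coeffBasis π))).comap
    (WithLp.linearEquiv 2 ℂ (G → ℂ) : EuclideanSpace ℂ G →ₗ[ℂ] (G → ℂ))
  apply_mem_toSubmodule g f hf := by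
    have hle : Submodule.span ℂ (Set.range (coeffBasis π)) ≤
        (Submodule.span ℂ (Set.range (coeffBasis π))).comap (LinearMap.funLeft ℂ ℂ (· * g)) := by
      rw [Submodule.span_le]
      rintro _ ⟨⟨c, i, j⟩, rfl⟩
      -- Since `π(xg) = π(x) π(g)`, right translation mixes only coefficients of the same row `i`.
      have h : LinearMap.funLeft ℂ ℂ (· * g) (coeffBasis π ⟨c, i, j⟩) =
          ∑ k, (π c).mat g k j • coeffBasis π ⟨c, i, k⟩ := by
        funext x
        rw [LinearMap.funLeft_apply, coeffBasis_apply, IrredUnitaryRep.mat_mul, Matrix.mul_apply,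
          Finset.sum_apply, Finset.mul_sum]
        refine Finset.sum_congr rfl fun k _ => ?_
        rw [Pi.smul_apply, coeffBasis_apply, smul_eq_mul]
        ring
      rw [SetLike.mem_coe, Submodule.mem_comap, h]
      exact Submodule.sum_mem _ fun k _ =>
        Submodule.smul_mem _ _ (Submodule.subset_span ⟨_, rfl⟩)
    exact hle hf

omit [Fintype G] in
/-- An irreducible representation by isometries is equivalent to one of the representatives. -/
theorem exists_linearEquiv_representative (hπ : ∀ c, UnitaryDual.mk (π c) = c)
    {E : Type*} [NormedAddCommGroup E] [InnerProductSpace ℂ E] [FiniteDimensional ℂ E]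
    (ρ : Representation ℂ G E) (hρ : ρ.IsIrreducible)
    (hisom : ∀ g x y, inner ℂ (ρ g x) (ρ g y) = inner ℂ x y) :
    ∃ (c : UnitaryDual G) (e : E ≃ₗ[ℂ] (Fin (π c).degree → ℂ)),
      ∀ g x, e (ρ g x) = (π c).mat g *ᵥ e x := by
  obtain ⟨σ, e, he⟩ := IrredUnitaryRep.exists_linearEquiv ρ hρ hisom
  obtain ⟨f⟩ : Nonempty ((unitaryToRep σ.toHom).Equiv
      (unitaryToRep (π (UnitaryDual.mk σ)).toHom)) :=
    Quotient.exact (hπ (UnitaryDual.mk σ)).symm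
  refine ⟨UnitaryDual.mk σ, e.trans f.toLinearEquiv, fun g x => ?_⟩
  rw [LinearEquiv.trans_apply, LinearEquiv.trans_apply, he]
  exact f.toIntertwiningMap.isIntertwining _ _ g (e x)

/-- For `u` in `U`, `u(g)` is the value at `1` of the translate of `u` by `g`. Transported through
`U ≃ ℂ^d`, this is a fixed linear functional applied to `π(g) e(u)`, hence a combination of the
entries of `π(g)`. -/
theorem le_coeffSpan_of_isAtom (hπ : ∀ c, UnitaryDual.mk (π c) = c)
    (U : Subrepresentation (rightRegularRep G)) (hU : IsAtom U) : U ≤ coeffSpan π := by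
  have hirr := Representation.isIrreducible_toRepresentation hU
  have hisom : ∀ g (x y : U.toSubmodule),
      inner ℂ (U.toRepresentation g x) (U.toRepresentation g y) = inner ℂ x y :=
    fun g x y => inner_rightRegularRep g x.1 y.1
  obtain ⟨c, e, he⟩ := exists_linearEquiv_representative π hπ (E := U.toSubmodule)
    U.toRepresentation hirr hisom
  intro u hu
  let ev : (Fin (π c).degree → ℂ) →ₗ[ℂ] ℂ :=
    (EuclideanSpace.proj (𝕜 := ℂ) (1 : G) : EuclideanSpace ℂ G →ₗ[ℂ] ℂ) ∘ₗ
      U.toSubmodule.subtype ∘ₗ (e.symm : _ →ₗ[ℂ] _)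
  have hval : ∀ g, u g = ev ((π c).mat g *ᵥ e ⟨u, hu⟩) := fun g => by
    rw [← he]
    change u g = (e.symm (e _) : U.toSubmodule).1 1
    rw [e.symm_apply_apply]
    change u g = u (1 * g)
    rw [one_mul]
  have hsum : WithLp.ofLp u =
      ∑ i, ∑ j, (ev (Pi.single i 1) * e ⟨u, hu⟩ j) • fun g => (π c).mat g i j := by
    funext g
    rw [hval g, LinearMap.pi_apply_eq_sum_univ]
    simp only [Finset.sum_apply, Pi.smul_apply, smul_eq_mul, Matrix.mulVec, dotProduct,
      Finset.sum_mul]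
    refine Finset.sum_congr rfl fun i _ => Finset.sum_congr rfl fun j _ => ?_
    have : (fun j => if i = j then (1 : ℂ) else 0) = Pi.single i 1 := by
      funext j
      simp [Pi.single_apply, eq_comm]
    rw [this]
    ring
  change WithLp.ofLp u ∈ Submodule.span ℂ (Set.range (coeffBasis π))
  rw [hsum]
  exact Submodule.sum_mem _ fun i _ => Submodule.sum_mem _ fun j _ =>
    Submodule.smul_mem _ _ (coeff_mem_span π c i j)

theorem span_range_coeffBasis (hπ : ∀ c, UnitaryDual.mk (π c) = c) :
    Submodule.span ℂ (Set.range (coeffBasis π)) = ⊤ := by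
  have h := Representation.eq_top_of_forall_isAtom_le _ (coeffSpan π) (le_coeffSpan_of_isAtom π hπ)
  rw [eq_top_iff]
  intro f _
  have hf : WithLp.toLp 2 f ∈ coeffSpan π := by
    rw [h]
    exact Submodule.mem_top (R := ℂ)
  exact hf

theorem orthonormal_coeffBasis (hπ : ∀ c, UnitaryDual.mk (π c) = c) :
    Orthonormal ℂ fun a => (WithLp.toLp 2 (coeffBasis π a) : EuclideanSpace ℂ G) := by
  classical
  rw [orthonormal_iff_ite]
  rintro ⟨c, i, j⟩ ⟨c', k, l⟩
  have hinner : inner ℂ (WithLp.toLp 2 (coeffBasis π ⟨c, i, j⟩) : EuclideanSpace ℂ G)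
      (WithLp.toLp 2 (coeffBasis π ⟨c', k, l⟩)) =
      ((Real.sqrt ((π c).degree / Fintype.card G) : ℝ) : ℂ) *
        ((Real.sqrt ((π c').degree / Fintype.card G) : ℝ) : ℂ) *
        ∑ g, (π c').coeff k l g * star ((π c).coeff i j g) := by
    rw [PiLp.inner_apply, Finset.mul_sum]
    refine Finset.sum_congr rfl fun g _ => ?_
    simp only [coeffBasis_apply, RCLike.inner_apply, map_mul, Complex.conj_ofReal,
      IrredUnitaryRep.coeff, RCLike.star_def]
    ring
  rw [hinner]
  by_cases hc : c = c'
  · subst hc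
    rw [IrredUnitaryRep.sum_coeff_mul_star_coeff, sqrt_degree_div_card_mul_self]
    have hd : ((π c).degree : ℂ) ≠ 0 := by exact_mod_cast (π c).degree_pos.ne'
    have hN : (Fintype.card G : ℂ) ≠ 0 := by exact_mod_cast Fintype.card_ne_zero
    by_cases h : k = i ∧ l = j
    · obtain ⟨rfl, rfl⟩ := h
      rw [if_pos ⟨rfl, rfl⟩, if_pos rfl]
      field_simp
    · rw [if_neg h, if_neg, mul_zero]
      simpa [eq_comm] using h
  · rw [IrredUnitaryRep.sum_coeff_mul_star_coeff_of_ne (by rwa [hπ, hπ]), mul_zero, if_neg]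
    exact fun h => hc (congrArg Sigma.fst h)

theorem coeffBasis_ne_zero (hπ : ∀ c, UnitaryDual.mk (π c) = c) (a : CoeffIndex π) :
    coeffBasis π a ≠ 0 := fun h =>
  (orthonormal_coeffBasis π hπ).ne_zero a (by rw [h]; rfl)

/-! ### Eigenvectors of the adjacency and Laplacian matrices -/

omit [Fintype G] in
theorem mem_of_isConjClosed {S : Set G} (hS : IsConjClosed S) (g s : G) :
    g * s * g⁻¹ ∈ S ↔ s ∈ S := by
  conv_lhs => rw [← hS g]
  exact Set.InjOn.mem_image_iff (s := Set.univ) (fun a _ b _ h => by simpa using h)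
    (Set.subset_univ _) (Set.mem_univ _)

-- Conjugating by `g` permutes `S`, so the sum commutes with every `π(g)` and Schur's lemma applies.
open scoped Classical in
theorem IrredUnitaryRep.exists_sum_eq_smul_one {S : Set G} (hS : IsConjClosed S)
    (σ : IrredUnitaryRep G) :
    ∃ μ : ℂ, ∑ s, (if s ∈ S then (1 : ℂ) else 0) • σ.mat s = μ • 1 := by
  refine σ.exists_eq_smul_one_of_commute _ fun g => ?_
  rw [Matrix.mul_sum, Matrix.sum_mul]
  refine Fintype.sum_equiv (MulAut.conj g).toEquiv _ _ fun s => ?_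
  change _ = (if g * s * g⁻¹ ∈ S then (1 : ℂ) else 0) • σ.mat (g * s * g⁻¹) * σ.mat g
  simp only [mem_of_isConjClosed hS, Matrix.mul_smul, Matrix.smul_mul, ← mat_mul,
    inv_mul_cancel_right]

open scoped Classical in
theorem sum_adjMatrix_cayleyDigraph_mul (S : Set G) (f : G → ℂ) (x : G) :
    ∑ y, GraphSignal.adjMatrix (cayleyDigraph S) x y * f y =
      ∑ s, (if s ∈ S then (1 : ℂ) else 0) * f (x * s) := by
  refine (Fintype.sum_equiv (Equiv.mulLeft x) _ _ fun s => ?_).symm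
  simp [GraphSignal.adjMatrix, cayleyDigraph]

/-- Substituting `y = x s`, `A` sends `π_{i,j}` to the `(i, j)` entry of `π(x) ∑_{s∈S} π(s) = μ
π(x)`. -/
theorem exists_adjMatrix_mulVec_coeffBasis {S : Set G} (hS : IsConjClosed S) (a : CoeffIndex π) :
    ∃ μ : ℂ, GraphSignal.adjMatrix (cayleyDigraph S) *ᵥ coeffBasis π a = μ • coeffBasis π a := by
  classical
  obtain ⟨c, i, j⟩ := a
  obtain ⟨μ, hμ⟩ := (π c).exists_sum_eq_smul_one hS
  refine ⟨μ, funext fun x => ?_⟩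
  have h : ((π c).mat x * ∑ s, (if s ∈ S then (1 : ℂ) else 0) • (π c).mat s) i j =
      μ * (π c).mat x i j := by
    rw [hμ, Matrix.mul_smul, Matrix.mul_one, Matrix.smul_apply, smul_eq_mul]
  simp only [Matrix.mul_sum, Matrix.mul_smul, ← IrredUnitaryRep.mat_mul, Matrix.sum_apply,
    Matrix.smul_apply, smul_eq_mul] at h
  change ∑ y, _ * _ = _
  rw [sum_adjMatrix_cayleyDigraph_mul, Pi.smul_apply, smul_eq_mul]
  simp only [coeffBasis_apply]
  rw [mul_left_comm, ← h, Finset.mul_sum]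
  exact Finset.sum_congr rfl fun s _ => mul_left_comm _ _ _

/-- Every vertex has out-degree `|S|`. -/
theorem lapMatrix_cayleyDigraph [DecidableEq G] (S : Set G) :
    ∃ d : ℂ, GraphSignal.lapMatrix (cayleyDigraph S) =
      d • 1 - GraphSignal.adjMatrix (cayleyDigraph S) := by
  classical
  refine ⟨∑ s, if s ∈ S then (1 : ℂ) else 0, ?_⟩
  have h : ∀ v, ∑ w, GraphSignal.adjMatrix (cayleyDigraph S) v w =
      ∑ s, if s ∈ S then (1 : ℂ) else 0 := fun v => by
    simpa using sum_adjMatrix_cayleyDigraph_mul S (fun _ => 1) v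
  simp only [GraphSignal.lapMatrix, h, Matrix.smul_one_eq_diagonal]

theorem isOrthonormalEigenbasis_coeffBasis [DecidableEq G]
    (hπ : ∀ c, UnitaryDual.mk (π c) = c) (M : Matrix G G ℂ)
    (hM : ∀ a, ∃ μ : ℂ, M *ᵥ coeffBasis π a = μ • coeffBasis π a) :
    GraphSignal.IsOrthonormalEigenbasis M (coeffBasis π) where
  orthonormal := orthonormal_coeffBasis π hπ
  span_eq_top := span_range_coeffBasis π hπ
  eigenvector a := (hM a).imp fun _ h =>
    ⟨Module.End.mem_eigenspace_iff.mpr h, coeffBasis_ne_zero π hπ a⟩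

/-! ### The translation formula -/

theorem GraphSignal.fourier_single {V ι : Type*} [Fintype V] [DecidableEq V] [Fintype ι]
    (φ : ι → V → ℂ) (l : V) (a : ι) :
    GraphSignal.fourier φ (Pi.single l 1) a = star (φ a l) := by
  simp [GraphSignal.fourier, GraphSignal.basisMatrix]

omit [Fintype G] in
theorem IrredUnitaryRep.character_inv_mul (σ : IrredUnitaryRep G) (l k : G) :
    σ.character (l⁻¹ * k) = ∑ i, ∑ j, σ.mat k i j * star (σ.mat l i j) := by
  change (σ.mat (l⁻¹ * k)).trace = _
  rw [mat_mul, Matrix.trace_mul_comm, mat_inv]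
  simp [Matrix.trace, Matrix.mul_apply]

/-- Constancy of `ĝ` on the block of `π` lets it leave the sum over `i, j`, which is then the
character; the two normalising square roots multiply to `d_π / N`. -/
theorem conv_single_coeffBasis [DecidableEq G] (g : G → ℂ) (ghat : UnitaryDual G → ℂ)
    (hg : ∀ (c : UnitaryDual G) (i j : Fin (π c).degree),
      GraphSignal.fourier (coeffBasis π) g ⟨c, i, j⟩ = ghat c) (l k : G) :
    GraphSignal.conv (coeffBasis π) g (Pi.single l 1) k =
      1 / (Fintype.card G : ℂ) * ∑ c, (π c).degree * ghat c * (π c).character (l⁻¹ * k) := by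
  change ∑ a : CoeffIndex π, coeffBasis π a k * _ = _
  rw [Fintype.sum_sigma, Finset.mul_sum]
  refine Finset.sum_congr rfl fun c _ => ?_
  rw [Fintype.sum_prod_type, IrredUnitaryRep.character_inv_mul, Finset.mul_sum, Finset.mul_sum]
  refine Finset.sum_congr rfl fun i _ => ?_
  rw [Finset.mul_sum, Finset.mul_sum]
  refine Finset.sum_congr rfl fun j _ => ?_
  simp only [Pi.mul_apply, hg, GraphSignal.fourier_single, coeffBasis_apply, star_mul', RCLike.star_def,
    Complex.conj_ofReal]
  have h := sqrt_degree_div_card_mul_self π c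
  linear_combination ((π c).mat k i j * ghat c * (starRingEnd ℂ) ((π c).mat l i j)) * h

end CoeffBasis

theorem mainTheorem11 {G : Type*} [Group G] [Fintype G] [DecidableEq G]
    (S : Set G) (hS : IsConjClosed S)
    (π : UnitaryDual G → IrredUnitaryRep G) (hπ : ∀ c, UnitaryDual.mk (π c) = c) :
    GraphSignal.IsOrthonormalEigenbasis
        (GraphSignal.adjMatrix (cayleyDigraph S)) (coeffBasis π) ∧
    GraphSignal.IsOrthonormalEigenbasis
        (GraphSignal.lapMatrix (cayleyDigraph S)) (coeffBasis π) ∧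
    ∀ (g : G → ℂ) (ghat : UnitaryDual G → ℂ),
      (∀ (c : UnitaryDual G) (i j : Fin (π c).degree),
        GraphSignal.fourier (coeffBasis π) g ⟨c, i, j⟩ = ghat c) →
      ∀ l k : G,
        GraphSignal.translation (coeffBasis π) l g k =
          1 / ((Real.sqrt (Fintype.card G) : ℝ) : ℂ) *
            ∑ c : UnitaryDual G,
              ((π c).degree : ℂ) * ghat c * (π c).character (l⁻¹ * k) := by
  refine ⟨isOrthonormalEigenbasis_coeffBasis π hπ _ (exists_adjMatrix_mulVec_coeffBasis π hS),
    isOrthonormalEigenbasis_coeffBasis π hπ _ fun a => ?_, fun g ghat hg l k => ?_⟩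
  · obtain ⟨μ, hμ⟩ := exists_adjMatrix_mulVec_coeffBasis π hS a
    obtain ⟨d, hd⟩ := lapMatrix_cayleyDigraph S
    exact ⟨d - μ, by rw [hd, Matrix.sub_mulVec, Matrix.smul_mulVec, Matrix.one_mulVec, hμ, sub_smul]⟩
  · have hN : (0 : ℝ) < Fintype.card G := by exact_mod_cast Fintype.card_pos
    have hs : ((Real.sqrt (Fintype.card G) : ℝ) : ℂ) ≠ 0 :=
      Complex.ofReal_ne_zero.mpr (Real.sqrt_pos.mpr hN).ne'
    have hsq : ((Real.sqrt (Fintype.card G) : ℝ) : ℂ) * ((Real.sqrt (Fintype.card G) : ℝ) : ℂ) =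
        Fintype.card G := by
      rw [← Complex.ofReal_mul, Real.mul_self_sqrt hN.le]
      simp
    rw [GraphSignal.translation, Pi.smul_apply, smul_eq_mul, conv_single_coeffBasis π g ghat hg,
      ← mul_assoc, ← hsq]
    congr 1
    field_simp
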